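/- **Proposition 1 (Asymptotic normality of plug-in PPI++).** Fix a survey question. Let $P$ be the law of a pair $(X,Y)$ consisting of a prompt $X$ and a real human response $Y$, and let $Y^{\mathrm{LLM}}$ be the real prediction that a fixed, deterministic or stochastic, prediction rule produces from $X$ (that is, given $(X,Y)$, $Y^{\mathrm{LLM}}$ has law $\kappa(X,\cdot)$ for a fixed Markov kernel $\kappa$; in the deterministic case $Y^{\mathrm{LLM}}=f(X)$). The labeled data $(X_i,Y_i,Y_i^{\mathrm{LLM}})$, $i=1,2,\dots$, are i.i.d. copies of $(X,Y,Y^{\mathrm{LLM}})$. The synthetic pool $(\widetilde X_j,\widetilde Y_j^{\mathrm{LLM}})$, $j=1,2,\dots$, consists of i.i.d. copies of $(X,Y^{\mathrm{LLM}})$ and is independent of the labeled data. Assume that $Y$ and $Y^{\mathrm{LLM}}$ have finite fourth moments and that $\mathrm{Var}(Y)>0$. Let $\theta^\star=\mathrm{E}[Y]$, let $\lambda^\star$ be $\mathrm{Cov}(Y,Y^{\mathrm{LLM}})/\mathrm{Var}(Y^{\mathrm{LLM}})$ clipped to $[0,1]$ (with $\lambda^\star=0$ if $\mathrm{Var}(Y^{\mathrm{LLM}})=0$),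 and let $A=\mathrm{Var}(Y-\lambda^\star Y^{\mathrm{LLM}})$. For a labeled size $\tilde n$ and a synthetic size $m$, let $\widehat\lambda$ be the ratio $\widehat{\mathrm{Cov}}(Y,Y^{\mathrm{LLM}})/\widehat{\mathrm{Var}}(Y^{\mathrm{LLM}})$ of the empirical covariance and variance of the first $\tilde n$ labeled pairs $(Y_i,Y_i^{\mathrm{LLM}})$, clipped to $[0,1]$ (with $\widehat\lambda=0$ if $\widehat{\mathrm{Var}}(Y^{\mathrm{LLM}})=0$), and let $$\widehat\theta(\lambda)=\frac1{\tilde n}\sum_{i=1}^{\tilde n}Y_i+\lambda\Bigl(\frac1m\sum_{j=1}^{m}\widetilde Y_j^{\mathrm{LLM}}-\frac1{\tilde n}\sum_{i=1}^{\tilde n}Y_i^{\mathrm{LLM}}\Bigr),\qquad \sigma^2=\sigma_{\tilde n,m}^2=\frac{A}{\tilde n}+\frac{(\lambda^\star)^2\,\mathrm{Var}(Y^{\mathrm{LLM}})}{m}.$$ Then, as $\tilde n\to\infty$ and $m\to\infty$ jointly, with no restriction on their relative rates, $$\frac{\widehat\theta(\widehat\lambda)-\theta^\star}{\sigma}\xrightarrow{d}\mathcal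 N(0,1).$$ The boundary cases $\lambda^\star\in\{0,1\}$ and $\mathrm{Var}(Y^{\mathrm{LLM}})=0$ are included. -/

import Mathlib

open MeasureTheory ProbabilityTheory Filter

namespace PPI

noncomputable section

section Population

variable {𝒳 : Type*} [MeasurableSpace 𝒳]

/-- Law of a labeled triple `((X, Y), Y^LLM)`: the prompt and the human response `(X, Y)` are drawn
from `P`, and, given them, the LLM prediction is drawn from `κ X`. A deterministic prediction rule
`f` is the kernel `Kernel.deterministic f`. -/
def labeledLaw (P : Measure (𝒳 × ℝ)) (κ : Kernel 𝒳 ℝ) : Measure ((𝒳 × ℝ) × ℝ) :=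
  P ⊗ₘ (κ.prodMkRight ℝ)

/-- Law of a synthetic pair `(X, Y^LLM)`: the prompt is drawn from the prompt marginal of `P`, and
the LLM prediction is drawn from `κ X`. -/
def syntheticLaw (P : Measure (𝒳 × ℝ)) (κ : Kernel 𝒳 ℝ) : Measure (𝒳 × ℝ) :=
  P.fst ⊗ₘ κ

/-- Joint law of `(Y, Y^LLM)` in the population. -/
def pairLaw (P : Measure (𝒳 × ℝ)) (κ : Kernel 𝒳 ℝ) : Measure (ℝ × ℝ) :=
  (labeledLaw P κ).map (fun z => (z.1.2, z.2))

/-- The estimand `θ* = E[Y]`. -/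
def thetaStar (P : Measure (𝒳 × ℝ)) : ℝ :=
  ∫ z, z.2 ∂P

end Population

/-- Clipping to `[0, 1]`. -/
def clip (x : ℝ) : ℝ :=
  max 0 (min 1 x)

/-- The population tuning parameter `λ*` of a joint law `ν` of `(Y, Y^LLM)`:
`Cov(Y, Y^LLM) / Var(Y^LLM)` clipped to `[0, 1]`, and `0` if `Var(Y^LLM) = 0`. -/
def lambdaStar (ν : Measure (ℝ × ℝ)) : ℝ :=
  if Var[fun p => p.2; ν] = 0 then 0
  else clip (cov[fun p => p.1, fun p => p.2; ν] / Var[fun p => p.2; ν])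

/-- The rectification difficulty `A = Var(Y - λ* Y^LLM)`. -/
def rectDifficulty (ν : Measure (ℝ × ℝ)) : ℝ :=
  Var[fun p => p.1 - lambdaStar ν * p.2; ν]

/-- The scale `σ`, where `σ² = A / n + (λ*)² Var(Y^LLM) / m`. -/
def sigma (ν : Measure (ℝ × ℝ)) (n m : ℕ) : ℝ :=
  Real.sqrt (rectDifficulty ν / n + lambdaStar ν ^ 2 * Var[fun p => p.2; ν] / m)

/-- Average of the first `n` terms of a sequence. -/
def sampleMean (n : ℕ) (y : ℕ → ℝ) : ℝ :=
  (∑ i ∈ Finset.range n, y i) / n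

/-- Empirical covariance of the first `n` terms of two sequences. -/
def sampleCov (n : ℕ) (y l : ℕ → ℝ) : ℝ :=
  (∑ i ∈ Finset.range n, (y i - sampleMean n y) * (l i - sampleMean n l)) / n

/-- Empirical variance of the first `n` terms of a sequence. -/
def sampleVar (n : ℕ) (l : ℕ → ℝ) : ℝ :=
  (∑ i ∈ Finset.range n, (l i - sampleMean n l) ^ 2) / n

/-- The plug-in tuning parameter `λ̂`, computed from the first `n` labeled pairs. -/
def lambdaHat (n : ℕ) (y l : ℕ → ℝ) : ℝ :=
  if sampleVar n l = 0 then 0 else clip (sampleCov n y l / sampleVar n l)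

/-- The PPI++ estimator `θ̂(lam)`, from `n` labeled pairs `(y i, l i)` and `m` synthetic
predictions `l' j`. -/
def thetaHat (n m : ℕ) (y l l' : ℕ → ℝ) (lam : ℝ) : ℝ :=
  sampleMean n y + lam * (sampleMean m l' - sampleMean n l)

/-- The sampling model: the labeled triples `((X i, Y i), L i)` are i.i.d. with law
`labeledLaw P κ`, the synthetic pairs `(X' j, L' j)` are i.i.d. with law `syntheticLaw P κ`, and
the labeled sample is independent of the synthetic pool. -/
structure IsSample {𝒳 Ω : Type*} [MeasurableSpace 𝒳] [MeasurableSpace Ω]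
    (P : Measure (𝒳 × ℝ)) (κ : Kernel 𝒳 ℝ) (μ : Measure Ω)
    (X : ℕ → Ω → 𝒳) (Y L : ℕ → Ω → ℝ) (X' : ℕ → Ω → 𝒳) (L' : ℕ → Ω → ℝ) : Prop where
  labeled_law : ∀ i, HasLaw (fun ω => ((X i ω, Y i ω), L i ω)) (labeledLaw P κ) μ
  labeled_indep : iIndepFun (fun i ω => ((X i ω, Y i ω), L i ω)) μ
  synthetic_law : ∀ j, HasLaw (fun ω => (X' j ω, L' j ω)) (syntheticLaw P κ) μ
  synthetic_indep : iIndepFun (fun j ω => (X' j ω, L' j ω)) μ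
  indep : IndepFun (fun ω (i : ℕ) => ((X i ω, Y i ω), L i ω)) (fun ω (j : ℕ) => (X' j ω, L' j ω)) μ

end

end PPI

open scoped Topology

namespace PPI

/-! Splitting `λ̂ = λ* + (λ̂ - λ*)` turns the studentized error into `leadingTerm`, which is the
estimator run with the true `λ*`, plus `tuningError`, which is `λ̂ - λ*` times the difference of the
two prediction means over `σ` (`thetaHat_sub_div_sigma_eq`). By Slutsky it remains to find the limit
law of the first and to show that the second vanishes in probability.

The leading term is a sum of two independent normalized i.i.d. sums whose weights lie on the unit
circle. The weights need not converge, since the ratio of the sample sizes is unrestricted; but by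
compactness every sequence of sample sizes has a subsequence along which they do. There the central
limit theorem applies to each block, the characteristic functions multiply, and the limit is
standard normal whatever the limiting weights are.

The tuning error vanishes for one of three reasons (`lambdaHat_trichotomy`). Either `λ̂ = λ*`
eventually, almost surely. Or `A` and `λ*` are positive: then `√n σ` and `√m σ` stay away from zero,
and consistency of `λ̂` suffices. Or `λ* = 0` with zero covariance: `σ = √(A / n)` ignores the pool,
so consistency is not enough when `m` is much smaller than `n`; but `λ̂` is `O(n ^ (-1 / 2))` in
probability, the order of `σ`, and it multiplies a difference of means that tends to zero. -/

/-- The centered and normalized sum `(√n)⁻¹ (x 0 + ⋯ + x (n - 1) - n c)`. -/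
noncomputable def scaledSum (n : ℕ) (x : ℕ → ℝ) (c : ℝ) : ℝ :=
  (√n)⁻¹ * (∑ i ∈ Finset.range n, x i - n * c)

theorem sampleMean_sub_eq {n : ℕ} (hn : 0 < n) (x : ℕ → ℝ) (c : ℝ) :
    sampleMean n x - c = (√n)⁻¹ * scaledSum n x c := by
  have hn' : (0 : ℝ) < n := by exact_mod_cast hn
  have h : (√n)⁻¹ * (√n)⁻¹ = (n : ℝ)⁻¹ := by
    rw [← mul_inv, Real.mul_self_sqrt hn'.le]
  rw [sampleMean, scaledSum, ← mul_assoc, h]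
  field_simp

/-! ### Convergence in measure and the law of large numbers -/

section Convergence

variable {Ω : Type*} [MeasurableSpace Ω] {μ : Measure Ω}

theorem _root_.AEMeasurable.scaledSum {X : ℕ → Ω → ℝ} (hX : ∀ i, AEMeasurable (X i) μ)
    (n : ℕ) (c : ℝ) : AEMeasurable (fun ω => scaledSum n (fun i => X i ω) c) μ := by
  unfold PPI.scaledSum
  have := Finset.aemeasurable_fun_sum (Finset.range n) (fun i _ => hX i)
  fun_prop

theorem tendstoInMeasure_zero_of_abs_le {f g : ℕ → Ω → ℝ}
    (hf : TendstoInMeasure μ f atTop 0) (hgf : ∀ᶠ k in atTop, ∀ ω, |g k ω| ≤ |f k ω|) :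
    TendstoInMeasure μ g atTop 0 := by
  rw [tendstoInMeasure_iff_norm] at hf ⊢
  intro ε hε
  refine tendsto_of_tendsto_of_tendsto_of_le_of_le' tendsto_const_nhds (hf ε hε)
    (Eventually.of_forall fun _ => zero_le) ?_
  filter_upwards [hgf] with k hk
  refine measure_mono fun ω hω => ?_
  simp only [Pi.zero_apply, sub_zero, Real.norm_eq_abs, Set.mem_ofPred_eq] at hω ⊢
  exact hω.trans (hk ω)

theorem tendstoInMeasure_zero_add {f g : ℕ → Ω → ℝ}
    (hf : TendstoInMeasure μ f atTop 0) (hg : TendstoInMeasure μ g atTop 0) :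
    TendstoInMeasure μ (fun k ω => f k ω + g k ω) atTop 0 := by
  rw [tendstoInMeasure_iff_norm] at hf hg ⊢
  intro ε hε
  have h := (hf (ε / 2) (by positivity)).add (hg (ε / 2) (by positivity))
  rw [add_zero] at h
  refine tendsto_of_tendsto_of_tendsto_of_le_of_le tendsto_const_nhds h
    (fun _ => zero_le) fun k => ?_
  refine (measure_mono fun ω hω => ?_).trans (measure_union_le _ _)
  simp only [Pi.zero_apply, sub_zero, Real.norm_eq_abs, Set.mem_ofPred_eq, Set.mem_union] at hω ⊢
  by_contra! hcon
  linarith [abs_add_le (f k ω) (g k ω)]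

/-- A sequence tending to `0` in measure times a sequence bounded in probability (with a Chebyshev
tail bound) tends to `0` in measure. -/
theorem tendstoInMeasure_zero_mul [IsProbabilityMeasure μ] {e U : ℕ → Ω → ℝ} {C : ℝ}
    (he : TendstoInMeasure μ e atTop 0)
    (hU : ∀ k, ∀ M > 0, μ.real {ω | M ≤ |U k ω|} ≤ C / M ^ 2) :
    TendstoInMeasure μ (fun k ω => e k ω * U k ω) atTop 0 := by
  rw [tendstoInMeasure_iff_measureReal_norm] at he ⊢
  intro ε hε
  rw [Metric.tendsto_atTop]
  intro η hη
  have hlim : Tendsto (fun M : ℝ => C / M ^ 2) atTop (𝓝 0) :=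
    tendsto_const_nhds.div_atTop (tendsto_pow_atTop two_ne_zero)
  -- The level `M` makes the tail of `U` cost less than `η / 2`, uniformly in `k`; the other half of
  -- `η` pays for `ε / M ≤ |e k|`.
  obtain ⟨M, hM, hM0⟩ :=
    ((hlim.eventually_lt_const (half_pos hη)).and (eventually_gt_atTop 0)).exists
  obtain ⟨N, hN⟩ := Metric.tendsto_atTop.1 (he (ε / M) (by positivity)) (η / 2) (half_pos hη)
  refine ⟨N, fun k hk => ?_⟩
  have h1 := hN k hk
  have h2 := hU k M hM0
  simp only [Pi.zero_apply, sub_zero, Real.norm_eq_abs, dist_zero_right,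
    abs_of_nonneg measureReal_nonneg] at h1 ⊢
  have hsub : {ω | ε ≤ |e k ω * U k ω|} ⊆ {ω | ε / M ≤ |e k ω|} ∪ {ω | M ≤ |U k ω|} := by
    intro ω hω
    simp only [Set.mem_ofPred_eq, Set.mem_union] at hω ⊢
    by_contra! hcon
    have : |e k ω * U k ω| < ε / M * M := by
      rw [abs_mul]
      exact mul_lt_mul'' hcon.1 hcon.2 (abs_nonneg _) (abs_nonneg _)
    rw [div_mul_cancel₀ _ hM0.ne'] at this
    linarith
  have h3 : μ.real {ω | ε ≤ |e k ω * U k ω|} ≤ _ :=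
    (measureReal_mono hsub).trans (measureReal_union_le _ _)
  linarith

theorem ae_tendsto_sampleMean {X : ℕ → Ω → ℝ} (hX : Integrable (X 0) μ) (hindep : iIndepFun X μ)
    (hident : ∀ i, IdentDistrib (X i) (X 0) μ μ) :
    ∀ᵐ ω ∂μ, Tendsto (fun n => sampleMean n fun i => X i ω) atTop (𝓝 μ[X 0]) :=
  strong_law_ae_real X hX (fun _ _ hij => hindep.indepFun hij) hident

end Convergence

/-! ### Tightness and the central limit theorem for i.i.d. sums -/

section IID

variable {Ω : Type*} [MeasurableSpace Ω] {μ : Measure Ω} [IsProbabilityMeasure μ] {X : ℕ → Ω → ℝ}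

/-- Chebyshev. The bound does not depend on `n`, which makes it the tightness hypothesis of
`tendstoInMeasure_zero_mul`. -/
theorem measureReal_le_abs_scaledSum_le (hX : MemLp (X 0) 2 μ) (hindep : iIndepFun X μ)
    (hident : ∀ i, IdentDistrib (X i) (X 0) μ μ) (n : ℕ) {M : ℝ} (hM : 0 < M) :
    μ.real {ω | M ≤ |scaledSum n (fun i => X i ω) μ[X 0]|} ≤ Var[X 0; μ] / M ^ 2 := by
  have hmem : ∀ i, MemLp (X i) 2 μ := fun i => (hident i).memLp_iff.2 hX
  rcases Nat.eq_zero_or_pos n with rfl | hn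
  · have : {ω | M ≤ |scaledSum 0 (fun i => X i ω) μ[X 0]|} = ∅ := by
      ext ω
      simp [scaledSum, hM]
    rw [this, measureReal_empty]
    exact div_nonneg (variance_nonneg _ _) (sq_nonneg _)
  have hn' : (0 : ℝ) < n := by exact_mod_cast hn
  have hsum : MemLp (∑ i ∈ Finset.range n, X i) 2 μ := memLp_finsetSum' _ fun i _ => hmem i
  have hmean : ∫ ω, (∑ i ∈ Finset.range n, X i) ω ∂μ = n * ∫ ω, X 0 ω ∂μ := by
    simp only [Finset.sum_apply]
    rw [integral_finsetSum _ fun i _ => (hmem i).integrable one_le_two]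
    simp [fun i => (hident i).integral_eq]
  have hvar : Var[∑ i ∈ Finset.range n, X i; μ] = n * Var[X 0; μ] := by
    rw [IndepFun.variance_sum (fun i _ => hmem i) fun i _ j _ hij => hindep.indepFun hij]
    simp [fun i => (hident i).variance_eq]
  have hcheb := meas_ge_le_variance_div_sq hsum (c := M * √n) (by positivity)
  rw [hmean, hvar, mul_pow, Real.sq_sqrt hn'.le] at hcheb
  have hset : {ω | M ≤ |scaledSum n (fun i => X i ω) μ[X 0]|} =
      {ω | M * √n ≤ |(∑ i ∈ Finset.range n, X i) ω - n * μ[X 0]|} := by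
    ext ω
    simp only [Set.mem_ofPred_eq, scaledSum, Finset.sum_apply]
    rw [abs_mul, abs_of_nonneg (by positivity : 0 ≤ (√n)⁻¹), ← div_eq_inv_mul,
      le_div_iff₀ (Real.sqrt_pos.2 hn')]
  rw [hset, measureReal_def]
  refine ENNReal.toReal_le_of_le_ofReal (div_nonneg (variance_nonneg _ _) (sq_nonneg _))
    (hcheb.trans_eq ?_)
  congr 1
  field_simp

/-- The central limit theorem for characteristic functions, along a sequence of sample sizes and
with varying scales `b k`. The variance may vanish. -/
theorem tendsto_charFun_mul_scaledSum (hX : MemLp (X 0) 2 μ) (hindep : iIndepFun X μ)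
    (hident : ∀ i, IdentDistrib (X i) (X 0) μ μ) {n : ℕ → ℕ} (hn : Tendsto n atTop atTop)
    {b : ℕ → ℝ} {s : ℝ} (hb : Tendsto (fun k => b k * √Var[X 0; μ]) atTop (𝓝 s)) (t : ℝ) :
    Tendsto
      (fun k => charFun (μ.map fun ω => b k * scaledSum (n k) (fun i => X i ω) μ[X 0]) t)
      atTop (𝓝 (Complex.exp (-(s * t) ^ 2 / 2))) := by
  have hae : ∀ i, AEMeasurable (X i) μ := fun i => (hident i).aemeasurable_fst
  -- With zero variance nothing controls `b`, but the sums vanish almost surely and `s = 0` is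
  -- forced, so both sides equal `1`.
  rcases eq_or_ne Var[X 0; μ] 0 with h0 | h0
  · have hs : s = 0 := by
      refine tendsto_nhds_unique hb ?_
      simp [h0]
    have hconst : ∀ᵐ ω ∂μ, ∀ i, X i ω = μ[X 0] := by
      refine ae_all_iff.2 fun i => ?_
      rw [← (hident i).integral_eq]
      exact ae_eq_integral_of_variance_eq_zero ((hident i).memLp_iff.2 hX)
        ((hident i).variance_eq.trans h0)
    have hmap : ∀ k, μ.map (fun ω => b k * scaledSum (n k) (fun i => X i ω) μ[X 0]) =
        Measure.dirac 0 := by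
      intro k
      rw [Measure.map_congr (g := fun _ => (0 : ℝ)), Measure.map_const]
      · simp
      · filter_upwards [hconst] with ω hω
        simp [scaledSum, hω]
    simp [hmap, hs]
  · set v := Var[X 0; μ] with hv
    have hvpos : 0 < v := lt_of_le_of_ne (variance_nonneg _ _) h0.symm
    have hlaw : HasLaw (id : ℝ → ℝ) (gaussianReal 0 v.toNNReal) (gaussianReal 0 v.toNNReal) :=
      HasLaw.id
    have hclt := tendstoInDistribution_inv_sqrt_mul_sum_sub hlaw hX hindep hident
    have hsub : TendstoInDistribution
        (fun k ω => scaledSum (n k) (fun i => X i ω) μ[X 0]) atTop (id : ℝ → ℝ) (fun _ => μ)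
        (gaussianReal 0 v.toNNReal) :=
      ⟨fun k => hclt.forall_aemeasurable (n k), hclt.aemeasurable_limit, hclt.tendsto.comp hn⟩
    have hb' : Tendsto b atTop (𝓝 (s / √v)) := by
      have := hb.div_const (√v)
      refine this.congr fun k => ?_
      have := (Real.sqrt_pos.2 hvpos).ne'
      field_simp
    -- The deterministic scales are treated as random variables constant in `ω`, so that Slutsky's
    -- theorem gives the limit of the product.
    have hbm : TendstoInMeasure μ (fun k (_ : Ω) => b k) atTop (fun _ => s / √v) :=
      tendstoInMeasure_of_tendsto_ae (fun k => aestronglyMeasurable_const)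
        (Eventually.of_forall fun _ => hb')
    have hprod := hsub.continuous_comp_prodMk_of_tendstoInMeasure_const
      (g := fun p : ℝ × ℝ => p.2 * p.1) (by fun_prop) hbm (fun k => aemeasurable_const)
    have hchar := ProbabilityMeasure.tendsto_iff_tendsto_charFun.1 hprod.tendsto t
    simp only [ProbabilityMeasure.coe_mk] at hchar
    convert hchar using 2
    simp only [id_eq]
    rw [charFun_map_mul, charFun_gaussianReal, Real.coe_toNNReal _ hvpos.le]
    congr 1
    have hsq : ((√v : ℝ) : ℂ) ^ 2 = (v : ℂ) := by
      rw [← Complex.ofReal_pow, Real.sq_sqrt hvpos.le]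
    have hne : ((√v : ℝ) : ℂ) ≠ 0 := by
      exact_mod_cast (Real.sqrt_pos.2 hvpos).ne'
    push_cast
    rw [← hsq]
    field_simp
    ring

end IID

/-! ### Clipping and the algebra of empirical moments -/

theorem clip_nonneg (x : ℝ) : 0 ≤ clip x := le_max_left _ _

theorem clip_le_one (x : ℝ) : clip x ≤ 1 := max_le zero_le_one (min_le_left _ _)

theorem clip_eq_self {x : ℝ} (h0 : 0 ≤ x) (h1 : x ≤ 1) : clip x = x := by
  rw [clip, min_eq_right h1, max_eq_right h0]

theorem clip_eq_zero {x : ℝ} (hx : x ≤ 0) : clip x = 0 :=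
  max_eq_left ((min_le_right _ _).trans hx)

theorem clip_pos {x : ℝ} (hx : 0 < x) : 0 < clip x :=
  lt_max_of_lt_right (lt_min zero_lt_one hx)

theorem abs_clip_le (x : ℝ) : |clip x| ≤ |x| := by
  rw [abs_of_nonneg (clip_nonneg x)]
  exact max_le (abs_nonneg x) ((min_le_right _ _).trans (le_abs_self x))

theorem continuous_clip : Continuous clip := by
  unfold clip
  fun_prop

theorem sampleVar_eq_sampleCov (n : ℕ) (l : ℕ → ℝ) : sampleVar n l = sampleCov n l l := by
  simp only [sampleVar, sampleCov, sq]

/-- Empirical covariance is invariant under shifts. Centering at `0` yields consistency; centering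
at the population means makes the correction a product of two small factors. -/
theorem sampleCov_eq_sub {n : ℕ} (hn : 0 < n) (y l : ℕ → ℝ) (c d : ℝ) :
    sampleCov n y l = sampleMean n (fun i => (y i - c) * (l i - d))
      - (sampleMean n y - c) * (sampleMean n l - d) := by
  have hn' : (n : ℝ) ≠ 0 := by exact_mod_cast hn.ne'
  have hy : ∑ i ∈ Finset.range n, y i = n * sampleMean n y := by
    rw [sampleMean]; field_simp
  have hl : ∑ i ∈ Finset.range n, l i = n * sampleMean n l := by
    rw [sampleMean]; field_simp
  have h1 : ∀ a b : ℝ, ∑ i ∈ Finset.range n, (y i - a) * (l i - b) =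
      ∑ i ∈ Finset.range n, y i * l i - n * sampleMean n y * b - n * sampleMean n l * a
        + n * (a * b) := by
    intro a b
    rw [← hy, ← hl, Finset.sum_mul, Finset.sum_mul, ← Finset.sum_sub_distrib,
      ← Finset.sum_sub_distrib]
    have : (n : ℝ) * (a * b) = ∑ _i ∈ Finset.range n, a * b := by simp
    rw [this, ← Finset.sum_add_distrib]
    exact Finset.sum_congr rfl fun i _ => by ring
  have h2 := h1 c d
  rw [sampleCov, h1, show sampleMean n (fun i => (y i - c) * (l i - d)) =
    (∑ i ∈ Finset.range n, (y i - c) * (l i - d)) / n from rfl, h2]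
  field_simp
  ring

theorem sampleMean_mul_add {n : ℕ} (hn : 0 < n) (l : ℕ → ℝ) (a c : ℝ) :
    sampleMean n (fun i => a * l i + c) = a * sampleMean n l + c := by
  have hn' : (n : ℝ) ≠ 0 := by exact_mod_cast hn.ne'
  simp only [sampleMean, Finset.sum_add_distrib, ← Finset.mul_sum]
  simp
  field_simp

/-- On perfectly affine data the empirical covariance is the slope times the empirical variance. -/
theorem sampleCov_of_affine (n : ℕ) {y l : ℕ → ℝ} {a c : ℝ} (h : ∀ i, y i = a * l i + c) :
    sampleCov n y l = a * sampleVar n l := by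
  rcases Nat.eq_zero_or_pos n with rfl | hn
  · simp [sampleCov, sampleVar]
  have hy : y = fun i => a * l i + c := funext h
  rw [sampleVar, sampleCov, hy, sampleMean_mul_add hn l a c, ← mul_div_assoc,
    Finset.mul_sum]
  congr 1
  exact Finset.sum_congr rfl fun i _ => by ring

theorem sampleVar_of_const (n : ℕ) {l : ℕ → ℝ} {c : ℝ} (h : ∀ i, l i = c) :
    sampleVar n l = 0 := by
  rcases Nat.eq_zero_or_pos n with rfl | hn
  · simp [sampleVar]
  rw [sampleVar_eq_sampleCov, sampleCov_eq_sub hn l l c c]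
  have hn' : (n : ℝ) ≠ 0 := by exact_mod_cast hn.ne'
  simp [sampleMean, h, hn']

/-! ### Measurability of the statistics -/

section Measurability

theorem measurable_sampleMean (n : ℕ) : Measurable (sampleMean n) := by
  unfold sampleMean
  fun_prop

theorem measurable_sampleCov (n : ℕ) :
    Measurable fun p : (ℕ → ℝ) × (ℕ → ℝ) => sampleCov n p.1 p.2 := by
  have := measurable_sampleMean n
  unfold sampleCov
  fun_prop

theorem measurable_sampleVar (n : ℕ) : Measurable (sampleVar n) := by
  have := measurable_sampleMean n
  unfold sampleVar
  fun_prop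

theorem measurable_lambdaHat (n : ℕ) :
    Measurable fun p : (ℕ → ℝ) × (ℕ → ℝ) => lambdaHat n p.1 p.2 := by
  have h1 := (measurable_sampleVar n).comp
    (measurable_snd : Measurable (Prod.snd : (ℕ → ℝ) × (ℕ → ℝ) → ℕ → ℝ))
  exact Measurable.ite (measurableSet_eq_fun h1 measurable_const) measurable_const
    (continuous_clip.measurable.comp ((measurable_sampleCov n).div h1))

end Measurability

/-! ### Population parameters -/

section Population

variable {ν : Measure (ℝ × ℝ)}

theorem lambdaStar_nonneg (ν : Measure (ℝ × ℝ)) : 0 ≤ lambdaStar ν := by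
  unfold lambdaStar
  split_ifs
  · exact le_rfl
  · exact clip_nonneg _

theorem lambdaStar_le_one (ν : Measure (ℝ × ℝ)) : lambdaStar ν ≤ 1 := by
  unfold lambdaStar
  split_ifs
  · exact zero_le_one
  · exact clip_le_one _

theorem variance_pos_of_lambdaStar_ne_zero (h : lambdaStar ν ≠ 0) :
    0 < Var[fun p => p.2; ν] := by
  refine lt_of_le_of_ne (variance_nonneg _ _) fun h0 => h ?_
  rw [lambdaStar, if_pos h0.symm]

theorem rectDifficulty_of_lambdaStar_eq_zero (h : lambdaStar ν = 0) :
    rectDifficulty ν = Var[fun p => p.1; ν] := by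
  simp [rectDifficulty, h]

theorem rectDifficulty_nonneg (ν : Measure (ℝ × ℝ)) : 0 ≤ rectDifficulty ν := variance_nonneg _ _

theorem sigma_sq {n m : ℕ} : sigma ν n m ^ 2 =
    rectDifficulty ν / n + lambdaStar ν ^ 2 * Var[fun p => p.2; ν] / m := by
  have := rectDifficulty_nonneg ν
  have := variance_nonneg (fun p : ℝ × ℝ => p.2) ν
  rw [sigma, Real.sq_sqrt (by positivity)]

/-- If `λ* = 0`, then `A` is the variance of the response, which is positive; otherwise the
synthetic term is positive, even when `A = 0`. -/
theorem sigma_pos (hvar : 0 < Var[fun p => p.1; ν]) {n m : ℕ} (hn : 0 < n) (hm : 0 < m) :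
    0 < sigma ν n m := by
  have hn' : (0 : ℝ) < n := by exact_mod_cast hn
  have hm' : (0 : ℝ) < m := by exact_mod_cast hm
  have hA := rectDifficulty_nonneg ν
  refine Real.sqrt_pos.2 ?_
  by_cases ha : lambdaStar ν = 0
  · rw [rectDifficulty_of_lambdaStar_eq_zero ha, ha]
    simpa using div_pos hvar hn'
  · have := variance_pos_of_lambdaStar_ne_zero ha
    have := lt_of_le_of_ne (lambdaStar_nonneg ν) (Ne.symm ha)
    positivity

end Population

/-! ### Reduced sampling model and consistency of the tuning parameter -/

/-- The part of the sampling model that involves only the responses and predictions: i.i.d. pairs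
`(Y i, L i)` with law `ν`, and an independent i.i.d. sequence `L' j` with the law of the second
coordinate under `ν`. -/
structure IsPairSample {Ω : Type*} [MeasurableSpace Ω] (ν : Measure (ℝ × ℝ)) (μ : Measure Ω)
    (Y L L' : ℕ → Ω → ℝ) : Prop where
  labeled_law : ∀ i, HasLaw (fun ω => (Y i ω, L i ω)) ν μ
  labeled_indep : iIndepFun (fun i ω => (Y i ω, L i ω)) μ
  synthetic_law : ∀ j, HasLaw (L' j) (ν.map Prod.snd) μ
  synthetic_indep : iIndepFun L' μ
  indep : IndepFun (fun ω (i : ℕ) => (Y i ω, L i ω)) (fun ω (j : ℕ) => L' j ω) μ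

namespace IsPairSample

variable {Ω : Type*} [MeasurableSpace Ω] {ν : Measure (ℝ × ℝ)} {μ : Measure Ω}
  {Y L L' : ℕ → Ω → ℝ} {f : ℝ × ℝ → ℝ}

theorem identDistrib (h : IsPairSample ν μ Y L L') (hf : Measurable f) (i : ℕ) :
    IdentDistrib (fun ω => f (Y i ω, L i ω)) (fun ω => f (Y 0 ω, L 0 ω)) μ μ :=
  ((h.labeled_law i).identDistrib (h.labeled_law 0)).comp hf

theorem iIndepFun_comp (h : IsPairSample ν μ Y L L') (hf : Measurable f) :
    iIndepFun (fun i ω => f (Y i ω, L i ω)) μ :=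
  h.labeled_indep.comp (fun _ => f) fun _ => hf

theorem memLp_comp (h : IsPairSample ν μ Y L L') {p : ENNReal} (hf : MemLp f p ν) (i : ℕ) :
    MemLp (fun ω => f (Y i ω, L i ω)) p μ := by
  rw [← (h.labeled_law i).map_eq] at hf
  exact hf.comp_of_map (h.labeled_law i).aemeasurable

theorem integral_comp (h : IsPairSample ν μ Y L L') (hf : Measurable f) (i : ℕ) :
    ∫ ω, f (Y i ω, L i ω) ∂μ = ∫ p, f p ∂ν :=
  (h.labeled_law i).integral_comp hf.aestronglyMeasurable

theorem variance_comp (h : IsPairSample ν μ Y L L') (hf : Measurable f) (i : ℕ) :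
    Var[fun ω => f (Y i ω, L i ω); μ] = Var[f; ν] := by
  rw [← (h.labeled_law i).map_eq, variance_map hf.aemeasurable (h.labeled_law i).aemeasurable]
  rfl

theorem synthetic_identDistrib (h : IsPairSample ν μ Y L L') (j : ℕ) :
    IdentDistrib (L' j) (L' 0) μ μ :=
  (h.synthetic_law j).identDistrib (h.synthetic_law 0)

theorem synthetic_identDistrib_labeled (h : IsPairSample ν μ Y L L') :
    IdentDistrib (L' 0) (L 0) μ μ := by
  refine (h.synthetic_law 0).identDistrib ⟨(h.labeled_law 0).aemeasurable.snd, ?_⟩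
  rw [← (h.labeled_law 0).map_eq,
    AEMeasurable.map_map_of_aemeasurable measurable_snd.aemeasurable (h.labeled_law 0).aemeasurable]
  rfl

theorem synthetic_memLp (h : IsPairSample ν μ Y L L') {p : ENNReal}
    (hL : MemLp (fun p => p.2) p ν) : MemLp (L' 0) p μ :=
  h.synthetic_identDistrib_labeled.memLp_iff.2 (h.memLp_comp hL 0)

theorem synthetic_integral (h : IsPairSample ν μ Y L L') :
    ∫ ω, L' 0 ω ∂μ = ∫ p, p.2 ∂ν :=
  h.synthetic_identDistrib_labeled.integral_eq.trans (h.integral_comp measurable_snd 0)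

theorem synthetic_variance (h : IsPairSample ν μ Y L L') :
    Var[L' 0; μ] = Var[fun p => p.2; ν] :=
  h.synthetic_identDistrib_labeled.variance_eq.trans (h.variance_comp measurable_snd 0)

theorem ae_tendsto_sampleMean_comp (h : IsPairSample ν μ Y L L') (hf : Measurable f)
    (hint : Integrable f ν) :
    ∀ᵐ ω ∂μ, Tendsto (fun n => sampleMean n fun i => f (Y i ω, L i ω)) atTop (𝓝 (∫ p, f p ∂ν)) := by
  rw [← h.integral_comp hf 0]
  exact ae_tendsto_sampleMean (memLp_one_iff_integrable.1
    (h.memLp_comp (memLp_one_iff_integrable.2 hint) 0)) (h.iIndepFun_comp hf) (h.identDistrib hf)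

theorem ae_tendsto_sampleMean_synthetic [IsFiniteMeasure ν] (h : IsPairSample ν μ Y L L')
    (hL : MemLp (fun p => p.2) 2 ν) :
    ∀ᵐ ω ∂μ, Tendsto (fun m => sampleMean m fun j => L' j ω) atTop (𝓝 (∫ p, p.2 ∂ν)) := by
  rw [← h.synthetic_integral]
  exact ae_tendsto_sampleMean (memLp_one_iff_integrable.1
    (h.synthetic_memLp (hL.mono_exponent one_le_two))) h.synthetic_indep h.synthetic_identDistrib

/-- The empirical covariance of two square integrable statistics is strongly consistent. -/
theorem ae_tendsto_sampleCov [IsProbabilityMeasure ν] (h : IsPairSample ν μ Y L L')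
    {f g : ℝ × ℝ → ℝ} (hf : Measurable f) (hg : Measurable g)
    (hf2 : MemLp f 2 ν) (hg2 : MemLp g 2 ν) :
    ∀ᵐ ω ∂μ, Tendsto (fun n => sampleCov n (fun i => f (Y i ω, L i ω)) fun i => g (Y i ω, L i ω))
      atTop (𝓝 cov[f, g; ν]) := by
  filter_upwards [h.ae_tendsto_sampleMean_comp hf (hf2.integrable one_le_two),
    h.ae_tendsto_sampleMean_comp hg (hg2.integrable one_le_two),
    h.ae_tendsto_sampleMean_comp (hf.mul hg) (hf2.integrable_mul hg2)] with ω h1 h2 h3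
  rw [covariance_eq_sub hf2 hg2]
  refine (h3.sub (h1.mul h2)).congr' ?_
  filter_upwards [eventually_gt_atTop 0] with n hn
  rw [sampleCov_eq_sub hn _ _ 0 0]
  simp

theorem ae_tendsto_sampleVar [IsProbabilityMeasure ν] (h : IsPairSample ν μ Y L L')
    (hL : MemLp (fun p => p.2) 2 ν) :
    ∀ᵐ ω ∂μ, Tendsto (fun n => sampleVar n fun i => L i ω) atTop (𝓝 Var[fun p => p.2; ν]) := by
  simp only [sampleVar_eq_sampleCov]
  rw [← covariance_self measurable_snd.aemeasurable]
  exact h.ae_tendsto_sampleCov measurable_snd measurable_snd hL hL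

/-- Strong consistency of the plug-in tuning parameter. -/
theorem ae_tendsto_lambdaHat [IsProbabilityMeasure ν] (h : IsPairSample ν μ Y L L')
    (hY : MemLp (fun p => p.1) 2 ν) (hL : MemLp (fun p => p.2) 2 ν)
    (hV : 0 < Var[fun p => p.2; ν]) :
    ∀ᵐ ω ∂μ, Tendsto (fun n => lambdaHat n (fun i => Y i ω) fun i => L i ω) atTop
      (𝓝 (lambdaStar ν)) := by
  filter_upwards [h.ae_tendsto_sampleCov measurable_fst measurable_snd hY hL,
    h.ae_tendsto_sampleVar hL] with ω h1 h2
  rw [lambdaStar, if_neg hV.ne']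
  refine ((continuous_clip.tendsto _).comp (h1.div h2 hV.ne')).congr' ?_
  filter_upwards [h2.eventually_ne hV.ne'] with n hn
  simp [lambdaHat, hn]

theorem aemeasurable_lambdaHat (h : IsPairSample ν μ Y L L') (n : ℕ) :
    AEMeasurable (fun ω => lambdaHat n (fun i => Y i ω) fun i => L i ω) μ := by
  have hY : AEMeasurable (fun ω i => Y i ω) μ :=
    aemeasurable_pi_lambda _ fun i => (h.labeled_law i).aemeasurable.fst
  have hL : AEMeasurable (fun ω i => L i ω) μ :=
    aemeasurable_pi_lambda _ fun i => (h.labeled_law i).aemeasurable.snd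
  have hYL := (measurable_lambdaHat n).comp_aemeasurable (hY.prodMk hL)
  exact hYL

/-- Either the plug-in tuning parameter is eventually exact, or the problem is non-degenerate, or
the responses and predictions are uncorrelated. -/
theorem lambdaHat_trichotomy [IsProbabilityMeasure μ] [IsProbabilityMeasure ν]
    (h : IsPairSample ν μ Y L L')
    (hY : MemLp (fun p => p.1) 2 ν) (hL : MemLp (fun p => p.2) 2 ν) :
    (∀ᵐ ω ∂μ, ∀ᶠ n in atTop, lambdaHat n (fun i => Y i ω) (fun i => L i ω) = lambdaStar ν) ∨
    (0 < rectDifficulty ν ∧ 0 < lambdaStar ν) ∨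
    (lambdaStar ν = 0 ∧ 0 < Var[fun p => p.2; ν] ∧ cov[fun p => p.1, fun p => p.2; ν] = 0) := by
  rcases (variance_nonneg (fun p : ℝ × ℝ => p.2) ν).eq_or_lt with hV | hV
  · left
    have hstar : lambdaStar ν = 0 := by rw [lambdaStar, if_pos hV.symm]
    have hconst : ∀ᵐ ω ∂μ, ∀ i, L i ω = ∫ p, p.2 ∂ν := by
      refine ae_all_iff.2 fun i => ?_
      rw [← h.integral_comp measurable_snd i]
      exact ae_eq_integral_of_variance_eq_zero (h.memLp_comp hL i)
        ((h.variance_comp measurable_snd i).trans hV.symm)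
    filter_upwards [hconst] with ω hω
    refine Eventually.of_forall fun n => ?_
    rw [lambdaHat, if_pos (sampleVar_of_const n hω), hstar]
  rcases (lambdaStar_nonneg ν).eq_or_lt with ha | ha
  · have hclip : clip (cov[fun p => p.1, fun p => p.2; ν] / Var[fun p => p.2; ν]) = 0 := by
      rw [lambdaStar, if_neg hV.ne'] at ha
      exact ha.symm
    rcases lt_trichotomy cov[fun p => p.1, fun p => p.2; ν] 0 with hC | hC | hC
    -- A negative limiting covariance makes the empirical ratio eventually negative, and clipping
    -- then returns exactly `0`.
    · left
      filter_upwards [h.ae_tendsto_sampleCov measurable_fst measurable_snd hY hL,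
        h.ae_tendsto_sampleVar hL] with ω h1 h2
      filter_upwards [h1.eventually_lt_const hC, h2.eventually_const_lt hV] with n hn1 hn2
      rw [lambdaHat, if_neg hn2.ne', ← ha]
      exact clip_eq_zero (div_neg_of_neg_of_pos hn1 hn2).le
    · exact Or.inr (Or.inr ⟨ha.symm, hV, hC⟩)
    · exact absurd hclip (clip_pos (div_pos hC hV)).ne'
  · rcases (rectDifficulty_nonneg ν).eq_or_lt with hA | hA
    -- If `A = 0`, the responses are almost surely an affine function of the predictions with slope
    -- `λ*`, and the empirical ratio recovers that slope without error.
    · left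
      have hm : Measurable fun p : ℝ × ℝ => p.1 - lambdaStar ν * p.2 := by fun_prop
      have hWL : MemLp (fun p : ℝ × ℝ => p.1 - lambdaStar ν * p.2) 2 ν :=
        hY.sub (hL.const_mul _)
      have hconst : ∀ᵐ ω ∂μ, ∀ i, Y i ω = lambdaStar ν * L i ω +
          ∫ p, (p.1 - lambdaStar ν * p.2) ∂ν := by
        refine ae_all_iff.2 fun i => ?_
        have := ae_eq_integral_of_variance_eq_zero (h.memLp_comp hWL i)
          ((h.variance_comp hm i).trans hA.symm)
        rw [h.integral_comp hm i] at this
        filter_upwards [this] with ω hω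
        rw [← hω]
        ring
      filter_upwards [hconst, h.ae_tendsto_sampleVar hL] with ω hω h2
      filter_upwards [h2.eventually_const_lt hV] with n hn
      rw [lambdaHat, if_neg hn.ne', sampleCov_of_affine n hω, mul_div_cancel_right₀ _ hn.ne']
      exact clip_eq_self (lambdaStar_nonneg ν) (lambdaStar_le_one ν)
    · exact Or.inr (Or.inl ⟨hA, ha⟩)

end IsPairSample

/-! ### Bounds on the scale and the two variance shares -/

section Scale

variable {ν : Measure (ℝ × ℝ)}

theorem sigma_nonneg (ν : Measure (ℝ × ℝ)) (n m : ℕ) : 0 ≤ sigma ν n m := Real.sqrt_nonneg _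

/-- Dropping the synthetic term of `σ ^ 2` gives a lower bound that is uniform in `m`; the next
lemma drops the labeled term. -/
theorem sqrt_rectDifficulty_le (ν : Measure (ℝ × ℝ)) {n : ℕ} (hn : 0 < n) (m : ℕ) :
    √(rectDifficulty ν) ≤ √n * sigma ν n m := by
  have hn' : (0 : ℝ) < n := by exact_mod_cast hn
  have := variance_nonneg (fun p : ℝ × ℝ => p.2) ν
  refine Real.sqrt_le_iff.2 ⟨mul_nonneg (Real.sqrt_nonneg _) (sigma_nonneg ν n m), ?_⟩
  rw [mul_pow, Real.sq_sqrt hn'.le, sigma_sq, mul_add, mul_div_cancel₀ _ hn'.ne']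
  have : 0 ≤ (n : ℝ) * (lambdaStar ν ^ 2 * Var[fun p => p.2; ν] / m) := by positivity
  linarith

theorem lambdaStar_mul_sqrt_variance_le (ν : Measure (ℝ × ℝ)) (n : ℕ) {m : ℕ} (hm : 0 < m) :
    lambdaStar ν * √Var[fun p => p.2; ν] ≤ √m * sigma ν n m := by
  have hm' : (0 : ℝ) < m := by exact_mod_cast hm
  have := rectDifficulty_nonneg ν
  refine (pow_le_pow_iff_left₀ (mul_nonneg (lambdaStar_nonneg ν) (Real.sqrt_nonneg _))
    (mul_nonneg (Real.sqrt_nonneg _) (sigma_nonneg ν n m)) two_ne_zero).1 ?_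
  rw [mul_pow, mul_pow, Real.sq_sqrt hm'.le,
    Real.sq_sqrt (variance_nonneg (fun p : ℝ × ℝ => p.2) ν), sigma_sq, mul_add,
    mul_div_cancel₀ _ hm'.ne']
  have : 0 ≤ (m : ℝ) * (rectDifficulty ν / n) := by positivity
  linarith

/-- The share of the labeled sample in the standard deviation `σ`. -/
noncomputable def labeledWeight (ν : Measure (ℝ × ℝ)) (n m : ℕ) : ℝ :=
  (√n * sigma ν n m)⁻¹ * √(rectDifficulty ν)

/-- The share of the synthetic pool in the standard deviation `σ`. -/
noncomputable def syntheticWeight (ν : Measure (ℝ × ℝ)) (n m : ℕ) : ℝ :=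
  lambdaStar ν * (√m * sigma ν n m)⁻¹ * √Var[fun p => p.2; ν]

theorem labeledWeight_sq_add_syntheticWeight_sq (hvar : 0 < Var[fun p => p.1; ν]) {n m : ℕ}
    (hn : 0 < n) (hm : 0 < m) : labeledWeight ν n m ^ 2 + syntheticWeight ν n m ^ 2 = 1 := by
  have hn' : (0 : ℝ) < n := by exact_mod_cast hn
  have hm' : (0 : ℝ) < m := by exact_mod_cast hm
  have hσ := sigma_pos hvar hn hm
  have h : labeledWeight ν n m ^ 2 + syntheticWeight ν n m ^ 2 =
      (rectDifficulty ν / n + lambdaStar ν ^ 2 * Var[fun p => p.2; ν] / m) / sigma ν n m ^ 2 := by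
    simp only [labeledWeight, syntheticWeight, mul_pow, inv_pow, Real.sq_sqrt hn'.le,
      Real.sq_sqrt hm'.le, Real.sq_sqrt (rectDifficulty_nonneg ν),
      Real.sq_sqrt (variance_nonneg (fun p : ℝ × ℝ => p.2) ν)]
    field_simp
  rw [h, ← sigma_sq, div_self (by positivity)]

end Scale

/-! ### Leading term and tuning error -/

namespace IsPairSample

variable {Ω : Type*} [MeasurableSpace Ω] {ν : Measure (ℝ × ℝ)} {μ : Measure Ω}
  [IsProbabilityMeasure μ] {Y L L' : ℕ → Ω → ℝ} {n m : ℕ → ℕ}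


theorem tendsto_charFun_labeled (h : IsPairSample ν μ Y L L') {f : ℝ × ℝ → ℝ}
    (hf : Measurable f) (hf2 : MemLp f 2 ν) (hn : Tendsto n atTop atTop)
    {b : ℕ → ℝ} {s : ℝ} (hb : Tendsto (fun k => b k * √Var[f; ν]) atTop (𝓝 s)) (t : ℝ) :
    Tendsto (fun k => charFun
        (μ.map fun ω => b k * scaledSum (n k) (fun i => f (Y i ω, L i ω)) (∫ p, f p ∂ν)) t)
      atTop (𝓝 (Complex.exp (-(s * t) ^ 2 / 2))) := by
  rw [← h.variance_comp hf 0] at hb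
  rw [← h.integral_comp hf 0]
  exact tendsto_charFun_mul_scaledSum (h.memLp_comp hf2 0) (h.iIndepFun_comp hf)
    (h.identDistrib hf) hn hb t

theorem tendsto_charFun_synthetic (h : IsPairSample ν μ Y L L')
    (hL : MemLp (fun p => p.2) 2 ν) (hm : Tendsto m atTop atTop)
    {b : ℕ → ℝ} {s : ℝ}
    (hb : Tendsto (fun k => b k * √Var[fun p => p.2; ν]) atTop (𝓝 s)) (t : ℝ) :
    Tendsto (fun k => charFun
        (μ.map fun ω => b k * scaledSum (m k) (fun j => L' j ω) (∫ p, p.2 ∂ν)) t)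
      atTop (𝓝 (Complex.exp (-(s * t) ^ 2 / 2))) := by
  rw [← h.synthetic_variance] at hb
  rw [← h.synthetic_integral]
  exact tendsto_charFun_mul_scaledSum (h.synthetic_memLp hL) h.synthetic_indep
    h.synthetic_identDistrib hm hb t

/-- The leading term of the studentized estimator: the labeled rectifier plus the synthetic
average, both centered, over `σ`. -/
noncomputable def leadingTerm (ν : Measure (ℝ × ℝ)) (n m : ℕ) (y l l' : ℕ → ℝ) : ℝ :=
  (√n * sigma ν n m)⁻¹ * scaledSum n (fun i => y i - lambdaStar ν * l i)
      (∫ p, (p.1 - lambdaStar ν * p.2) ∂ν) +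
    lambdaStar ν * (√m * sigma ν n m)⁻¹ * scaledSum m l' (∫ p, p.2 ∂ν)

/-- The two blocks are independent, so the characteristic functions multiply to `exp (-(s ^ 2 + c ^
2) t ^ 2 / 2)`. Only `s ^ 2 + c ^ 2` enters the limit, and either share may vanish. -/
theorem tendstoInDistribution_leadingTerm (h : IsPairSample ν μ Y L L')
    (hY : MemLp (fun p => p.1) 2 ν) (hL : MemLp (fun p => p.2) 2 ν)
    (hn : Tendsto n atTop atTop) (hm : Tendsto m atTop atTop) {s c : ℝ} (hsc : s ^ 2 + c ^ 2 = 1)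
    (hs : Tendsto (fun k => labeledWeight ν (n k) (m k)) atTop (𝓝 s))
    (hc : Tendsto (fun k => syntheticWeight ν (n k) (m k)) atTop (𝓝 c)) :
    TendstoInDistribution
      (fun k ω => leadingTerm ν (n k) (m k) (fun i => Y i ω) (fun i => L i ω) fun j => L' j ω)
      atTop (id : ℝ → ℝ) (fun _ => μ) (gaussianReal 0 1) := by
  have hfm : Measurable fun p : ℝ × ℝ => p.1 - lambdaStar ν * p.2 := by fun_prop
  have hf2 : MemLp (fun p : ℝ × ℝ => p.1 - lambdaStar ν * p.2) 2 ν := hY.sub (hL.const_mul _)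
  have hm1 : ∀ k, AEMeasurable (fun ω => (√(n k) * sigma ν (n k) (m k))⁻¹ *
      scaledSum (n k) (fun i => Y i ω - lambdaStar ν * L i ω)
        (∫ p, (p.1 - lambdaStar ν * p.2) ∂ν)) μ := fun k =>
    (AEMeasurable.scaledSum (X := fun i ω => Y i ω - lambdaStar ν * L i ω)
      (fun i => (h.identDistrib hfm i).aemeasurable_fst) _ _).const_mul _
  have hm2 : ∀ k, AEMeasurable (fun ω => lambdaStar ν * (√(m k) * sigma ν (n k) (m k))⁻¹ *
      scaledSum (m k) (fun j => L' j ω) (∫ p, p.2 ∂ν)) μ := fun k =>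
    (AEMeasurable.scaledSum (fun j => (h.synthetic_law j).aemeasurable) _ _).const_mul _
  refine ⟨fun k => (hm1 k).add (hm2 k), aemeasurable_id, ?_⟩
  refine ProbabilityMeasure.tendsto_iff_tendsto_charFun.2 fun t => ?_
  simp only [ProbabilityMeasure.coe_mk]
  have h1 := h.tendsto_charFun_labeled hfm hf2 hn (b := fun k => (√(n k) * sigma ν (n k) (m k))⁻¹)
    hs t
  have h2 := h.tendsto_charFun_synthetic hL hm
    (b := fun k => lambdaStar ν * (√(m k) * sigma ν (n k) (m k))⁻¹) hc t
  rw [Measure.map_id, charFun_gaussianReal]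
  have hlim : Complex.exp (-((s : ℂ) * t) ^ 2 / 2) * Complex.exp (-((c : ℂ) * t) ^ 2 / 2) =
      Complex.exp (t * (0 : ℝ) * Complex.I - ((1 : NNReal) : ℝ) * t ^ 2 / 2) := by
    rw [← Complex.exp_add]
    have hsc' : (s : ℂ) ^ 2 + (c : ℂ) ^ 2 = 1 := by exact_mod_cast hsc
    congr 1
    push_cast
    linear_combination (-(t : ℂ) ^ 2 / 2) * hsc'
  rw [← hlim]
  refine (h1.mul h2).congr fun k => ?_
  have hind : IndepFun (fun ω => (√(n k) * sigma ν (n k) (m k))⁻¹ *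
      scaledSum (n k) (fun i => Y i ω - lambdaStar ν * L i ω)
        (∫ p, (p.1 - lambdaStar ν * p.2) ∂ν))
      (fun ω => lambdaStar ν * (√(m k) * sigma ν (n k) (m k))⁻¹ *
        scaledSum (m k) (fun j => L' j ω) (∫ p, p.2 ∂ν)) μ := by
    have hφ : Measurable fun p : ℕ → ℝ × ℝ => (√(n k) * sigma ν (n k) (m k))⁻¹ *
        scaledSum (n k) (fun i => (p i).1 - lambdaStar ν * (p i).2)
          (∫ p, (p.1 - lambdaStar ν * p.2) ∂ν) := by
      unfold scaledSum
      fun_prop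
    have hψ : Measurable fun p : ℕ → ℝ => lambdaStar ν * (√(m k) * sigma ν (n k) (m k))⁻¹ *
        scaledSum (m k) p (∫ p, p.2 ∂ν) := by
      unfold scaledSum
      fun_prop
    exact h.indep.comp hφ hψ
  have := congrFun (hind.charFun_map_fun_add_eq_mul (hm1 k) (hm2 k)) t
  exact this.symm

theorem measureReal_scaledSum_labeled_le (h : IsPairSample ν μ Y L L') {f : ℝ × ℝ → ℝ}
    (hf : Measurable f) (hf2 : MemLp f 2 ν) (n : ℕ) {M : ℝ} (hM : 0 < M) :
    μ.real {ω | M ≤ |scaledSum n (fun i => f (Y i ω, L i ω)) (∫ p, f p ∂ν)|} ≤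
      Var[f; ν] / M ^ 2 := by
  rw [← h.variance_comp hf 0, ← h.integral_comp hf 0]
  exact measureReal_le_abs_scaledSum_le (h.memLp_comp hf2 0) (h.iIndepFun_comp hf)
    (h.identDistrib hf) n hM

theorem measureReal_scaledSum_synthetic_le (h : IsPairSample ν μ Y L L')
    (hL : MemLp (fun p => p.2) 2 ν) (m : ℕ) {M : ℝ} (hM : 0 < M) :
    μ.real {ω | M ≤ |scaledSum m (fun j => L' j ω) (∫ p, p.2 ∂ν)|} ≤
      Var[fun p => p.2; ν] / M ^ 2 := by
  rw [← h.synthetic_variance, ← h.synthetic_integral]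
  exact measureReal_le_abs_scaledSum_le (h.synthetic_memLp hL) h.synthetic_indep
    h.synthetic_identDistrib m hM

/-- The contribution of the estimation error of `λ̂`. -/
noncomputable def tuningError (ν : Measure (ℝ × ℝ)) (n m : ℕ) (y l l' : ℕ → ℝ) : ℝ :=
  (lambdaHat n y l - lambdaStar ν) * (sampleMean m l' - sampleMean n l) / sigma ν n m

theorem thetaHat_sub_div_sigma_eq [IsProbabilityMeasure ν] (hY : MemLp (fun p => p.1) 2 ν)
    (hL : MemLp (fun p => p.2) 2 ν) {n m : ℕ} (hn : 0 < n) (hm : 0 < m) (y l l' : ℕ → ℝ) :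
    (thetaHat n m y l l' (lambdaHat n y l) - ∫ p, p.1 ∂ν) / sigma ν n m =
      leadingTerm ν n m y l l' + tuningError ν n m y l l' := by
  have hmean : ∫ p, (p.1 - lambdaStar ν * p.2) ∂ν =
      (∫ p, p.1 ∂ν) - lambdaStar ν * ∫ p, p.2 ∂ν := by
    rw [integral_sub (hY.integrable one_le_two) ((hL.integrable one_le_two).const_mul _),
      integral_const_mul]
  have hsm : sampleMean n (fun i => y i - lambdaStar ν * l i) =
      sampleMean n y - lambdaStar ν * sampleMean n l := by
    simp only [sampleMean, Finset.sum_sub_distrib, ← Finset.mul_sum]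
    ring
  have h1 := sampleMean_sub_eq hn (fun i => y i - lambdaStar ν * l i)
    (∫ p, (p.1 - lambdaStar ν * p.2) ∂ν)
  have h2 := sampleMean_sub_eq hm l' (∫ p, p.2 ∂ν)
  have h3 : leadingTerm ν n m y l l' =
      ((sampleMean n (fun i => y i - lambdaStar ν * l i) -
          ∫ p, (p.1 - lambdaStar ν * p.2) ∂ν) +
        lambdaStar ν * (sampleMean m l' - ∫ p, p.2 ∂ν)) / sigma ν n m := by
    rw [h1, h2, leadingTerm, mul_inv, mul_inv]
    ring
  rw [h3, hsm, hmean, thetaHat, tuningError]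
  ring

/-- Both prediction means have the same expectation, so their difference is a combination of two
tight normalized sums with factors `(√m)⁻¹` and `(√n)⁻¹`. It is enough that `λ̂ - λ*` beats each of
these factors divided by `σ`. -/
theorem tendstoInMeasure_tuningError_of_ae (h : IsPairSample ν μ Y L L')
    (hL : MemLp (fun p => p.2) 2 ν) (hn : Tendsto n atTop atTop) (hm : Tendsto m atTop atTop)
    (h1 : ∀ᵐ ω ∂μ, Tendsto (fun k => (lambdaHat (n k) (fun i => Y i ω) (fun i => L i ω) -
      lambdaStar ν) * (√(n k) * sigma ν (n k) (m k))⁻¹) atTop (𝓝 0))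
    (h2 : ∀ᵐ ω ∂μ, Tendsto (fun k => (lambdaHat (n k) (fun i => Y i ω) (fun i => L i ω) -
      lambdaStar ν) * (√(m k) * sigma ν (n k) (m k))⁻¹) atTop (𝓝 0)) :
    TendstoInMeasure μ (fun k ω => tuningError ν (n k) (m k) (fun i => Y i ω) (fun i => L i ω)
      fun j => L' j ω) atTop 0 := by
  have hmeas : ∀ (c : ℝ) k, AEStronglyMeasurable (fun ω =>
      (lambdaHat (n k) (fun i => Y i ω) (fun i => L i ω) - lambdaStar ν) * c) μ := fun c k =>
    (((h.aemeasurable_lambdaHat (n k)).sub_const _).mul_const c).aestronglyMeasurable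
  have e1 := tendstoInMeasure_of_tendsto_ae (g := 0) (fun k => hmeas _ k) h1
  have e2 := tendstoInMeasure_of_tendsto_ae (g := 0) (fun k => hmeas _ k) h2
  have e1' : TendstoInMeasure μ (fun k ω => -((lambdaHat (n k) (fun i => Y i ω)
      (fun i => L i ω) - lambdaStar ν) * (√(n k) * sigma ν (n k) (m k))⁻¹)) atTop 0 :=
    tendstoInMeasure_zero_of_abs_le e1 (Eventually.of_forall fun k ω => (abs_neg _).le)
  refine tendstoInMeasure_zero_of_abs_le (tendstoInMeasure_zero_add
    (tendstoInMeasure_zero_mul e2 fun k M hM => h.measureReal_scaledSum_synthetic_le hL (m k) hM)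
    (tendstoInMeasure_zero_mul e1' fun k M hM =>
      h.measureReal_scaledSum_labeled_le measurable_snd hL (n k) hM)) ?_
  filter_upwards [hn.eventually_gt_atTop 0, hm.eventually_gt_atTop 0] with k hnk hmk ω
  refine (congrArg abs ?_).le
  have i1 := sampleMean_sub_eq hnk (fun i => L i ω) (∫ p, p.2 ∂ν)
  have i2 := sampleMean_sub_eq hmk (fun j => L' j ω) (∫ p, p.2 ∂ν)
  rw [tuningError, sub_eq_iff_eq_add.1 i1, sub_eq_iff_eq_add.1 i2, mul_inv, mul_inv]
  ring

end IsPairSample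

/-! ### Negligibility of the tuning error -/

theorem abs_lambdaHat_le (n : ℕ) (y l : ℕ → ℝ) :
    |lambdaHat n y l| ≤ |sampleCov n y l / sampleVar n l| := by
  unfold lambdaHat
  split_ifs with h
  · simp
  · exact abs_clip_le _

theorem isBoundedUnder_inv_sqrt_mul_sigma {ν : Measure (ℝ × ℝ)} (hA : 0 < rectDifficulty ν)
    {n : ℕ → ℕ} (hn : Tendsto n atTop atTop) (m : ℕ → ℕ) :
    IsBoundedUnder (· ≤ ·) atTop fun k => |(√(n k) * sigma ν (n k) (m k))⁻¹| := by
  refine isBoundedUnder_of_eventually_le (a := (√(rectDifficulty ν))⁻¹) ?_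
  filter_upwards [hn.eventually_gt_atTop 0] with k hk
  have hA' := Real.sqrt_pos.2 hA
  have := sqrt_rectDifficulty_le ν hk (m k)
  rw [abs_of_nonneg (inv_nonneg.2 (hA'.le.trans this))]
  exact inv_anti₀ hA' this

namespace IsPairSample

variable {Ω : Type*} [MeasurableSpace Ω] {ν : Measure (ℝ × ℝ)} {μ : Measure Ω}
  {Y L L' : ℕ → Ω → ℝ} {n m : ℕ → ℕ}

theorem aemeasurable_thetaHat (h : IsPairSample ν μ Y L L') (n m : ℕ) :
    AEMeasurable (fun ω => thetaHat n m (fun i => Y i ω) (fun i => L i ω) (fun j => L' j ω)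
      (lambdaHat n (fun i => Y i ω) fun i => L i ω)) μ := by
  have hY : AEMeasurable (fun ω i => Y i ω) μ :=
    aemeasurable_pi_lambda _ fun i => (h.labeled_law i).aemeasurable.fst
  have hL : AEMeasurable (fun ω i => L i ω) μ :=
    aemeasurable_pi_lambda _ fun i => (h.labeled_law i).aemeasurable.snd
  have hL' : AEMeasurable (fun ω j => L' j ω) μ :=
    aemeasurable_pi_lambda _ fun j => (h.synthetic_law j).aemeasurable
  exact ((measurable_sampleMean n).comp_aemeasurable hY).add ((h.aemeasurable_lambdaHat n).mul
    (((measurable_sampleMean m).comp_aemeasurable hL').sub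
      ((measurable_sampleMean n).comp_aemeasurable hL)))

variable [IsProbabilityMeasure μ] [IsProbabilityMeasure ν]

/-- When responses and predictions are uncorrelated, `λ̂` has order `n ^ (-1 / 2)`, which compensates
for the absence of the synthetic pool from `σ`. -/
theorem tendstoInMeasure_tuningError_of_covariance_eq_zero (h : IsPairSample ν μ Y L L')
    (hY : MemLp (fun p => p.1) 4 ν) (hL : MemLp (fun p => p.2) 4 ν)
    (hvar : 0 < Var[fun p => p.1; ν]) (hn : Tendsto n atTop atTop) (hm : Tendsto m atTop atTop)
    (ha : lambdaStar ν = 0) (hV : 0 < Var[fun p => p.2; ν])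
    (hC : cov[fun p => p.1, fun p => p.2; ν] = 0) :
    TendstoInMeasure μ (fun k ω => tuningError ν (n k) (m k) (fun i => Y i ω) (fun i => L i ω)
      fun j => L' j ω) atTop 0 := by
  have h24 : (2 : ENNReal) ≤ 4 := by norm_num
  have hY2 := hY.mono_exponent h24
  have hL2 := hL.mono_exponent h24
  set f : ℝ × ℝ → ℝ := fun p => (p.1 - ∫ q, q.1 ∂ν) * (p.2 - ∫ q, q.2 ∂ν)
  have hfm : Measurable f := by fun_prop
  -- Here fourth moments are needed: the centered product must be square integrable for its
  -- normalized sum to be tight.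
  have hf2 : MemLp f 2 ν := by
    have : ENNReal.HolderTriple 4 4 2 := ⟨by
      rw [← ENNReal.toReal_eq_toReal_iff' (by simp) (by simp),
        ENNReal.toReal_add (by simp) (by simp)]
      norm_num⟩
    exact (hL.sub (memLp_const _)).mul (hY.sub (memLp_const _))
  have hf0 : ∫ p, f p ∂ν = 0 := hC
  have hA : 0 < rectDifficulty ν := by
    rwa [rectDifficulty_of_lambdaStar_eq_zero ha]
  -- `q` collects all of the bound on `tuningError` except `√n` times the empirical covariance. It
  -- tends to zero because the two prediction means have the same limit.
  set q : ℕ → Ω → ℝ := fun k ω =>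
    (sampleMean (m k) (fun j => L' j ω) - sampleMean (n k) fun i => L i ω) /
      sampleVar (n k) (fun i => L i ω) * (√(n k) * sigma ν (n k) (m k))⁻¹
  have hmLab : AEMeasurable (fun ω i => L i ω) μ :=
    aemeasurable_pi_lambda _ fun i => (h.labeled_law i).aemeasurable.snd
  have hmSyn : AEMeasurable (fun ω j => L' j ω) μ :=
    aemeasurable_pi_lambda _ fun j => (h.synthetic_law j).aemeasurable
  have hmean : ∀ k, AEMeasurable (fun ω => sampleMean k fun i => L i ω) μ := fun k =>
    (measurable_sampleMean k).comp_aemeasurable hmLab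
  have hqm : ∀ k, AEMeasurable (q k) μ := fun k =>
    ((((measurable_sampleMean (m k)).comp_aemeasurable hmSyn).sub (hmean (n k))).div
      ((measurable_sampleVar (n k)).comp_aemeasurable hmLab)).mul_const _
  have hbdd := isBoundedUnder_inv_sqrt_mul_sigma hA hn m
  have hmeanL := h.ae_tendsto_sampleMean_comp measurable_snd (hL2.integrable one_le_two)
  have hq0 : ∀ᵐ ω ∂μ, Tendsto (fun k => q k ω) atTop (𝓝 0) := by
    filter_upwards [hmeanL, h.ae_tendsto_sampleMean_synthetic hL2, h.ae_tendsto_sampleVar hL2]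
      with ω h1 h2 h3
    have h4 := ((h2.comp hm).sub (h1.comp hn)).div (h3.comp hn) hV.ne'
    rw [sub_self, zero_div] at h4
    exact h4.zero_mul_isBoundedUnder_le hbdd
  have hr0 : ∀ᵐ ω ∂μ, Tendsto
      (fun k => -(q k ω * (sampleMean (n k) (fun i => L i ω) - ∫ p, p.2 ∂ν))) atTop (𝓝 0) := by
    filter_upwards [hq0, hmeanL] with ω h1 h2
    have h3 := (h1.mul ((h2.comp hn).sub_const (∫ p, p.2 ∂ν))).neg
    rw [zero_mul, neg_zero] at h3
    exact h3
  have e1 := tendstoInMeasure_of_tendsto_ae (g := 0) (fun k => (hqm k).aestronglyMeasurable) hq0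
  have e2 := tendstoInMeasure_of_tendsto_ae (g := 0)
    (f := fun k ω => -(q k ω * (sampleMean (n k) (fun i => L i ω) - ∫ p, p.2 ∂ν)))
    (fun k => ((hqm k).mul ((hmean (n k)).sub_const _)).neg.aestronglyMeasurable) hr0
  refine tendstoInMeasure_zero_of_abs_le (tendstoInMeasure_zero_add
    (tendstoInMeasure_zero_mul e1 fun k M hM =>
      h.measureReal_scaledSum_labeled_le hfm hf2 (n k) hM)
    (tendstoInMeasure_zero_mul e2 fun k M hM =>
      h.measureReal_scaledSum_labeled_le measurable_fst hY2 (n k) hM)) ?_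
  filter_upwards [hn.eventually_gt_atTop 0] with k hnk ω
  have hcov : sampleCov (n k) (fun i => Y i ω) (fun i => L i ω) =
      sampleMean (n k) (fun i => f (Y i ω, L i ω)) -
        (sampleMean (n k) (fun i => Y i ω) - ∫ p, p.1 ∂ν) *
          (sampleMean (n k) (fun i => L i ω) - ∫ p, p.2 ∂ν) := sampleCov_eq_sub hnk _ _ _ _
  have i1 := sampleMean_sub_eq hnk (fun i => f (Y i ω, L i ω)) 0
  have i2 := sampleMean_sub_eq hnk (fun i => Y i ω) (∫ p, p.1 ∂ν)
  rw [sub_zero] at i1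
  have hcov' : sampleCov (n k) (fun i => Y i ω) (fun i => L i ω) =
      (√(n k))⁻¹ * (scaledSum (n k) (fun i => f (Y i ω, L i ω)) 0 -
        scaledSum (n k) (fun i => Y i ω) (∫ p, p.1 ∂ν) *
          (sampleMean (n k) (fun i => L i ω) - ∫ p, p.2 ∂ν)) := by
    rw [hcov, i1, i2]
    ring
  have hrhs : q k ω * scaledSum (n k) (fun i => f (Y i ω, L i ω)) (∫ p, f p ∂ν) +
      -(q k ω * (sampleMean (n k) (fun i => L i ω) - ∫ p, p.2 ∂ν)) *
        scaledSum (n k) (fun i => Y i ω) (∫ p, p.1 ∂ν) =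
      sampleCov (n k) (fun i => Y i ω) (fun i => L i ω) / sampleVar (n k) (fun i => L i ω) *
        ((sampleMean (m k) (fun j => L' j ω) - sampleMean (n k) fun i => L i ω) /
          sigma ν (n k) (m k)) := by
    simp only [q, hcov', hf0, mul_inv]
    ring
  -- Since `λ* = 0`, the tuning error contains `λ̂` itself, and clipping only brings the empirical
  -- ratio closer to `0`.
  rw [hrhs, tuningError, ha, sub_zero, mul_div_assoc, abs_mul, abs_mul]
  exact mul_le_mul_of_nonneg_right (abs_lambdaHat_le _ _ _) (abs_nonneg _)

theorem tendstoInMeasure_tuningError (h : IsPairSample ν μ Y L L')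
    (hY : MemLp (fun p => p.1) 4 ν) (hL : MemLp (fun p => p.2) 4 ν)
    (hvar : 0 < Var[fun p => p.1; ν]) (hn : Tendsto n atTop atTop) (hm : Tendsto m atTop atTop) :
    TendstoInMeasure μ (fun k ω => tuningError ν (n k) (m k) (fun i => Y i ω) (fun i => L i ω)
      fun j => L' j ω) atTop 0 := by
  have h24 : (2 : ENNReal) ≤ 4 := by norm_num
  have hY2 := hY.mono_exponent h24
  have hL2 := hL.mono_exponent h24
  rcases h.lambdaHat_trichotomy hY2 hL2 with hex | ⟨hA, ha⟩ | ⟨ha, hV, hC⟩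
  · refine h.tendstoInMeasure_tuningError_of_ae hL2 hn hm ?_ ?_ <;>
    · filter_upwards [hex] with ω hω
      refine tendsto_const_nhds.congr' ?_
      filter_upwards [hn.eventually hω] with k hk
      rw [hk, sub_self, zero_mul]
  · have hV := variance_pos_of_lambdaStar_ne_zero ha.ne'
    have hV' := mul_pos ha (Real.sqrt_pos.2 hV)
    have hb1 := isBoundedUnder_inv_sqrt_mul_sigma hA hn m
    have hb2 : IsBoundedUnder (· ≤ ·) atTop fun k => |(√(m k) * sigma ν (n k) (m k))⁻¹| := by
      refine isBoundedUnder_of_eventually_le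
        (a := (lambdaStar ν * √Var[fun p => p.2; ν])⁻¹) ?_
      filter_upwards [hm.eventually_gt_atTop 0] with k hk
      have := lambdaStar_mul_sqrt_variance_le ν (n k) hk
      rw [abs_of_nonneg (inv_nonneg.2 (hV'.le.trans this))]
      exact inv_anti₀ hV' this
    have hlam := h.ae_tendsto_lambdaHat hY2 hL2 hV
    refine h.tendstoInMeasure_tuningError_of_ae hL2 hn hm ?_ ?_ <;>
    · filter_upwards [hlam] with ω hω
      have h0 := (hω.comp hn).sub_const (lambdaStar ν)
      rw [sub_self] at h0
      first
        | exact h0.zero_mul_isBoundedUnder_le hb1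
        | exact h0.zero_mul_isBoundedUnder_le hb2
  · exact h.tendstoInMeasure_tuningError_of_covariance_eq_zero hY hL hvar hn hm ha hV hC

/-- Asymptotic normality of the studentized plug-in estimator along a sequence of sample sizes for
which the two variance shares converge. -/
theorem tendstoInDistribution_thetaHat_of_tendsto_weights (h : IsPairSample ν μ Y L L')
    (hY : MemLp (fun p => p.1) 4 ν) (hL : MemLp (fun p => p.2) 4 ν)
    (hvar : 0 < Var[fun p => p.1; ν]) (hn : Tendsto n atTop atTop) (hm : Tendsto m atTop atTop)
    {s c : ℝ} (hs : Tendsto (fun k => labeledWeight ν (n k) (m k)) atTop (𝓝 s))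
    (hc : Tendsto (fun k => syntheticWeight ν (n k) (m k)) atTop (𝓝 c)) :
    TendstoInDistribution (fun k ω =>
      (thetaHat (n k) (m k) (fun i => Y i ω) (fun i => L i ω) (fun j => L' j ω)
        (lambdaHat (n k) (fun i => Y i ω) fun i => L i ω) - ∫ p, p.1 ∂ν) / sigma ν (n k) (m k))
      atTop (id : ℝ → ℝ) (fun _ => μ) (gaussianReal 0 1) := by
  have h24 : (2 : ENNReal) ≤ 4 := by norm_num
  have hY2 := hY.mono_exponent h24
  have hL2 := hL.mono_exponent h24
  -- The weights lie on the unit circle as soon as both sample sizes are positive, so the limit does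
  -- too.
  have hsc : s ^ 2 + c ^ 2 = 1 := by
    refine tendsto_nhds_unique ((hs.pow 2).add (hc.pow 2)) (tendsto_const_nhds.congr' ?_)
    filter_upwards [hn.eventually_gt_atTop 0, hm.eventually_gt_atTop 0] with k hnk hmk
    exact (labeledWeight_sq_add_syntheticWeight_sq hvar hnk hmk).symm
  refine tendstoInDistribution_of_tendstoInMeasure_sub _ _
    (h.tendstoInDistribution_leadingTerm hY2 hL2 hn hm hsc hs hc) ?_
    fun k => ((h.aemeasurable_thetaHat (n k) (m k)).sub_const _).div_const _
  refine tendstoInMeasure_zero_of_abs_le (h.tendstoInMeasure_tuningError hY hL hvar hn hm) ?_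
  filter_upwards [hn.eventually_gt_atTop 0, hm.eventually_gt_atTop 0] with k hnk hmk ω
  simp only [Pi.sub_apply]
  rw [thetaHat_sub_div_sigma_eq hY2 hL2 hnk hmk, add_sub_cancel_left]

theorem tendstoInDistribution_thetaHat (h : IsPairSample ν μ Y L L')
    (hY : MemLp (fun p => p.1) 4 ν) (hL : MemLp (fun p => p.2) 4 ν)
    (hvar : 0 < Var[fun p => p.1; ν]) :
    TendstoInDistribution (fun (k : ℕ × ℕ) ω =>
      (thetaHat k.1 k.2 (fun i => Y i ω) (fun i => L i ω) (fun j => L' j ω)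
        (lambdaHat k.1 (fun i => Y i ω) fun i => L i ω) - ∫ p, p.1 ∂ν) / sigma ν k.1 k.2)
      (atTop ×ˢ atTop) (id : ℝ → ℝ) (fun _ => μ) (gaussianReal 0 1) := by
  refine ⟨fun k => ((h.aemeasurable_thetaHat k.1 k.2).sub_const _).div_const _,
    aemeasurable_id, ?_⟩
  -- Convergence along the product filter follows if every sequence of pairs of sample sizes has a
  -- good subsequence; compactness of the square containing the weights supplies it.
  refine tendsto_of_subseq_tendsto fun ns hns => ?_
  have hn : Tendsto (fun k => (ns k).1) atTop atTop := tendsto_fst.comp hns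
  have hm : Tendsto (fun k => (ns k).2) atTop atTop := tendsto_snd.comp hns
  have hbdd : ∀ᶠ k in atTop, (labeledWeight ν (ns k).1 (ns k).2,
      syntheticWeight ν (ns k).1 (ns k).2) ∈ Set.Icc (-1 : ℝ) 1 ×ˢ Set.Icc (-1 : ℝ) 1 := by
    filter_upwards [hn.eventually_gt_atTop 0, hm.eventually_gt_atTop 0] with k hnk hmk
    have := labeledWeight_sq_add_syntheticWeight_sq hvar hnk hmk
    exact ⟨abs_le.1 (abs_le_one_iff_mul_self_le_one.2 (by nlinarith)),
      abs_le.1 (abs_le_one_iff_mul_self_le_one.2 (by nlinarith))⟩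
  obtain ⟨⟨s, c⟩, -, φ, hφ, hlim⟩ :=
    (isCompact_Icc.prod isCompact_Icc).tendsto_subseq' hbdd.frequently
  rw [nhds_prod_eq] at hlim
  refine ⟨φ, TendstoInDistribution.tendsto ?_⟩
  exact h.tendstoInDistribution_thetaHat_of_tendsto_weights hY hL hvar
    (hn.comp hφ.tendsto_atTop) (hm.comp hφ.tendsto_atTop) (tendsto_fst.comp hlim)
    (tendsto_snd.comp hlim)

end IsPairSample

/-! ### From the full sampling model to response–prediction pairs -/

section Sample

variable {𝒳 : Type*} [MeasurableSpace 𝒳] (P : Measure (𝒳 × ℝ)) [IsProbabilityMeasure P]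
  (κ : Kernel 𝒳 ℝ) [IsMarkovKernel κ]

theorem measurable_pair : Measurable fun z : (𝒳 × ℝ) × ℝ => (z.1.2, z.2) := by
  fun_prop

theorem isProbabilityMeasure_pairLaw : IsProbabilityMeasure (pairLaw P κ) := by
  unfold pairLaw labeledLaw
  exact Measure.isProbabilityMeasure_map measurable_pair.aemeasurable

theorem integral_fst_pairLaw : ∫ p, p.1 ∂(pairLaw P κ) = thetaStar P := by
  have h : thetaStar P = ∫ z, z.2 ∂(labeledLaw P κ).fst := by
    rw [labeledLaw, Measure.fst_compProd, thetaStar]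
  rw [h, Measure.fst, integral_map measurable_fst.aemeasurable
    measurable_snd.aestronglyMeasurable, pairLaw, integral_map measurable_pair.aemeasurable
    measurable_fst.aestronglyMeasurable]

/-- The kernel ignores the response, so averaging it over `P` or over the prompt marginal gives the
same law. This is why the synthetic predictions share the mean and variance of the labeled ones. -/
theorem map_snd_pairLaw : (pairLaw P κ).map Prod.snd = (syntheticLaw P κ).map Prod.snd := by
  rw [pairLaw, Measure.map_map measurable_snd measurable_pair]
  change (P ⊗ₘ κ.prodMkRight ℝ).snd = (P.fst ⊗ₘ κ).snd
  rw [Measure.snd_compProd, Measure.snd_compProd]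
  ext s hs
  rw [Measure.bind_apply hs (Kernel.aemeasurable _), Measure.bind_apply hs (Kernel.aemeasurable _),
    Measure.fst, lintegral_map (Kernel.measurable_coe κ hs) measurable_fst]
  rfl

variable {P κ}

theorem IsSample.isPairSample {Ω : Type*} [MeasurableSpace Ω] {μ : Measure Ω}
    {X : ℕ → Ω → 𝒳} {Y L : ℕ → Ω → ℝ} {X' : ℕ → Ω → 𝒳} {L' : ℕ → Ω → ℝ}
    (h : IsSample P κ μ X Y L X' L') : IsPairSample (pairLaw P κ) μ Y L L' where
  labeled_law i := by
    have hg : HasLaw (fun z : (𝒳 × ℝ) × ℝ => (z.1.2, z.2)) (pairLaw P κ) (labeledLaw P κ) :=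
      ⟨measurable_pair.aemeasurable, rfl⟩
    exact hg.comp (h.labeled_law i)
  labeled_indep := h.labeled_indep.comp (fun _ z => (z.1.2, z.2)) fun _ => measurable_pair
  synthetic_law j := by
    have hg : HasLaw Prod.snd ((pairLaw P κ).map Prod.snd) (syntheticLaw P κ) :=
      ⟨measurable_snd.aemeasurable, (map_snd_pairLaw P κ).symm⟩
    exact hg.comp (h.synthetic_law j)
  synthetic_indep := h.synthetic_indep.comp (fun _ z => z.2) fun _ => measurable_snd
  indep := by
    have h1 : Measurable fun (z : ℕ → (𝒳 × ℝ) × ℝ) (i : ℕ) => ((z i).1.2, (z i).2) := by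
      fun_prop
    have h2 : Measurable fun (z : ℕ → 𝒳 × ℝ) (j : ℕ) => (z j).2 := by fun_prop
    exact h.indep.comp h1 h2

end Sample

end PPI

theorem proposition1 {𝒳 Ω : Type*} [MeasurableSpace 𝒳] [MeasurableSpace Ω]
    (P : Measure (𝒳 × ℝ)) [IsProbabilityMeasure P]
    (κ : Kernel 𝒳 ℝ) [IsMarkovKernel κ]
    (μ : Measure Ω) [IsProbabilityMeasure μ]
    (X : ℕ → Ω → 𝒳) (Y L : ℕ → Ω → ℝ) (X' : ℕ → Ω → 𝒳) (L' : ℕ → Ω → ℝ)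
    (hsample : PPI.IsSample P κ μ X Y L X' L')
    (hY : MemLp (fun p : ℝ × ℝ => p.1) 4 (PPI.pairLaw P κ))
    (hL : MemLp (fun p : ℝ × ℝ => p.2) 4 (PPI.pairLaw P κ))
    (hvar : 0 < Var[fun p : ℝ × ℝ => p.1; PPI.pairLaw P κ]) :
    TendstoInDistribution
      (fun (k : ℕ × ℕ) (ω : Ω) =>
        (PPI.thetaHat k.1 k.2 (fun i => Y i ω) (fun i => L i ω) (fun j => L' j ω)
            (PPI.lambdaHat k.1 (fun i => Y i ω) (fun i => L i ω))
          - PPI.thetaStar P) / PPI.sigma (PPI.pairLaw P κ) k.1 k.2)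
      (atTop ×ˢ atTop) (id : ℝ → ℝ) (fun _ => μ) (gaussianReal 0 1) := by
  have := PPI.isProbabilityMeasure_pairLaw P κ
  rw [← PPI.integral_fst_pairLaw P κ]
  exact hsample.isPairSample.tendstoInDistribution_thetaHat hY hL hvar
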